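/- Consider the problem $\min f(x)$ subject to $h(x)=0$, $g(x)\ge 0$, where $f:\mathbb R^n\to\mathbb R$, $h:\mathbb R^n\to\mathbb R^{m_E}$, $g:\mathbb R^n\to\mathbb R^{m_I}$ are twice continuously differentiable with second derivatives that are Lipschitz continuous near a point $x^*$. For $\rho>0$ and $x,\mu,\lambda$ put $H_\rho(x,\mu,\lambda)=\rho\nabla^2 f(x)+\sum_i\mu_i\nabla^2h_i(x)-\sum_i\lambda_i\nabla^2g_i(x)$. Let $\rho_k>0$, $x_k\in\mathbb R^n$, $u_k,v_k\in\mathbb R^{m_E}$, $s_k,t_k\in\mathbb R^{m_I}$ be sequences, $\mu_k=u_k-v_k$, $\lambda_k=s_k$, $w_k=(x_k,\mu_k,\lambda_k)$, and suppose that for all large $k$ the iterates are generated by full SQP steps: $x_{k+1}=x_k+d_k$, where, for some $y_k^+,z_k^+$, $(d_k,y_k^+,z_k^+)$ is a KKT point, with multipliers $(u_{k+1},v_{k+1},s_{k+1},t_{k+1})$ of the four groups of constraints in the order written, of the quadratic program $$\min_{d,y,z}\ \sum_i y_i+\sum_i z_i+\rho_k\nabla f(x_k)^Td+\tfrac12 d^TH_{\rho_k}(x_k,\mu_k,\lambda_k)d$$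 $$\text{s.t. } y-h(x_k)-\nabla h(x_k)^Td\ge0,\quad y+h(x_k)+\nabla h(x_k)^Td\ge0,\quad z+g(x_k)+\nabla g(x_k)^Td\ge0,\quad z\ge0.$$ Let $u^*,v^*\in\mathbb R^{m_E}$, $s^*\in\mathbb R^{m_I}$, and let $\mu_i^*=\operatorname{sign}(h_i(x^*))$ if $h_i(x^*)\ne0$, $\mu_i^*=u_i^*-v_i^*$ if $h_i(x^*)=0$; $\lambda_i^*=1$ if $g_i(x^*)<0$, $\lambda_i^*=s_i^*$ if $g_i(x^*)=0$, $\lambda_i^*=0$ if $g_i(x^*)>0$; $w^*=(x^*,\mu^*,\lambda^*)$. Assume: (1) $w_k\to w^*$ and $\rho_k\to0$ as $k\to\infty$; (2) the gradients $\nabla h_i(x^*)$ ($h_i(x^*)=0$) and $\nabla g_i(x^*)$ ($g_i(x^*)=0$) are linearly independent; (3) $u_i^*,v_i^*\in(0,1)$ whenever $h_i(x^*)=0$, and $s_i^*\in(0,1)$ whenever $g_i(x^*)=0$; (4) $d^TB^*d>0$ for every $d\neq0$ with $\nabla h_i(x^*)^Td=0$ whenever $h_i(x^*)=0$ and $\nabla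 g_i(x^*)^Td=0$ whenever $g_i(x^*)=0$, where $B^*=\sum_i\mu_i^*\nabla^2h_i(x^*)-\sum_i\lambda_i^*\nabla^2g_i(x^*)$. Then $x^*$ is a DZ-stationary point, that is, a stationary point (nonnegative lower directional derivative in every direction) of $\|h(x)\|_1+\|\max\{0,-g(x)\}\|_1$ for which there are $\mu\in\mathbb R^{m_E}$, $\lambda\in\mathbb R^{m_I}_{+}$ with $-\nabla h(x^*)\mu-\nabla g(x^*)\lambda=0$, $\mu_ih_i(x^*)=-|h_i(x^*)|$ and $\lambda_ig_i(x^*)=-\max\{0,-g_i(x^*)\}$ for all $i$. Moreover $$\|w_{k+1}-w^*\|=O(\rho_k)+O(\|w_k-w^*\|^2)\qquad(k\to\infty).$$ Consequently, if $\rho_k=O(\|w_k-w^*\|^2)$, the convergence is quadratic, i.e. $\|w_{k+1}-w^*\|=O(\|w_k-w^*\|^2)$, and if $\rho_k=o(\|w_k-w^*\|)$, it is superlinear, i.e. $\|w_{k+1}-w^*\|=o(\|w_k-w^*\|)$. -/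

import Mathlib

open Filter Topology Asymptotics

noncomputable section

namespace LeastViolation

/-- Euclidean space `ℝⁿ`. -/
abbrev Vec (n : ℕ) := EuclideanSpace ℝ (Fin n)

/-- The stacked vector `w = (x, μ, lam)`, with the Euclidean norm of `ℝ^(n + mE + mI)`. -/
def stack {n mE mI : ℕ} (x : Vec n) (μ : Vec mE) (lam : Vec mI) :
    EuclideanSpace ℝ (Fin n ⊕ (Fin mE ⊕ Fin mI)) :=
  WithLp.toLp 2 (Sum.elim x.ofLp (Sum.elim μ.ofLp lam.ofLp))

/-- The Hessian `∇²φ(x)`, as a linear operator on `ℝⁿ`. -/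
def hess {n : ℕ} (φ : Vec n → ℝ) (x : Vec n) : Vec n →L[ℝ] Vec n :=
  fderiv ℝ (gradient φ) x

/-- The standing smoothness assumption at the limit `a`: the function is twice continuously
differentiable and its second derivative is Lipschitz continuous near `a`. -/
def SmoothNear {n : ℕ} (φ : Vec n → ℝ) (a : Vec n) : Prop :=
  ContDiff ℝ 2 φ ∧ ∃ K : NNReal, ∃ U ∈ 𝓝 a, LipschitzOnWith K (hess φ) U

/-- The curvature matrix `∑ μᵢ ∇²hᵢ(x) - ∑ lamᵢ ∇²gᵢ(x)` of the constraints. -/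
def constraintHess {n mE mI : ℕ} (h : Fin mE → Vec n → ℝ) (g : Fin mI → Vec n → ℝ)
    (x : Vec n) (μ : Vec mE) (lam : Vec mI) : Vec n →L[ℝ] Vec n :=
  ∑ i, μ i • hess (h i) x - ∑ i, lam i • hess (g i) x

/-- The exact Lagrangian Hessian `ρ ∇²f(x) + ∑ μᵢ ∇²hᵢ(x) - ∑ lamᵢ ∇²gᵢ(x)` of the penalty
problem. -/
def lagrangianHess {n mE mI : ℕ} (f : Vec n → ℝ) (h : Fin mE → Vec n → ℝ)
    (g : Fin mI → Vec n → ℝ) (ρ : ℝ) (x : Vec n) (μ : Vec mE) (lam : Vec mI) :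
    Vec n →L[ℝ] Vec n :=
  ρ • hess f x + constraintHess h g x μ lam

/-- The `ℓ₁` measure `c(x) = ‖h(x)‖₁ + ‖max {0, -g(x)}‖₁` of constraint violation of the
constraints `h(x) = 0`, `g(x) ≥ 0`. -/
def violation {n mE mI : ℕ} (h : Fin mE → Vec n → ℝ) (g : Fin mI → Vec n → ℝ)
    (x : Vec n) : ℝ :=
  ∑ i, |h i x| + ∑ i, max 0 (-(g i x))

/-- `a` is a (first-order) stationary point for minimizing `c`: the lower directional derivative
of `c` at `a` is nonnegative in every direction. -/
def IsStationaryFor {n : ℕ} (c : Vec n → ℝ) (a : Vec n) : Prop :=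
  ∀ d : Vec n, ∀ ε > 0, ∀ᶠ t : ℝ in 𝓝[>] 0, -ε ≤ (c (a + t • d) - c a) / t

/-- `a` is a DZ-stationary point of the problem with constraints `h(x) = 0`, `g(x) ≥ 0`. -/
def IsDZStationary {n mE mI : ℕ} (h : Fin mE → Vec n → ℝ) (g : Fin mI → Vec n → ℝ)
    (a : Vec n) : Prop :=
  IsStationaryFor (violation h g) a ∧
  ∃ (μ : Vec mE) (lam : Vec mI), (∀ i, 0 ≤ lam i) ∧
    -(∑ i, μ i • gradient (h i) a) - ∑ i, lam i • gradient (g i) a = 0 ∧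
    (∀ i, μ i * h i a = -|h i a|) ∧
    (∀ i, lam i * g i a = -max 0 (-(g i a)))

/-- `(d, y, z)` is a KKT point, with Lagrange multipliers `(u, v, s, t)`, of the quadratic program

minimize `∑ yᵢ + ∑ zᵢ + ρ ∇f(x)ᵀd + ½ dᵀBd` subject to
`y - h(x) - ∇h(x)ᵀd ≥ 0`, `y + h(x) + ∇h(x)ᵀd ≥ 0`, `z + g(x) + ∇g(x)ᵀd ≥ 0`, `z ≥ 0`. -/
structure IsQPKKT {n mE mI : ℕ} (f : Vec n → ℝ) (h : Fin mE → Vec n → ℝ)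
    (g : Fin mI → Vec n → ℝ) (ρ : ℝ) (x : Vec n) (B : Vec n →L[ℝ] Vec n)
    (d : Vec n) (y : Vec mE) (z : Vec mI) (u v : Vec mE) (s t : Vec mI) : Prop where
  feas_u : ∀ i, 0 ≤ y i - (h i x + inner ℝ (gradient (h i) x) d)
  feas_v : ∀ i, 0 ≤ y i + (h i x + inner ℝ (gradient (h i) x) d)
  feas_s : ∀ i, 0 ≤ z i + (g i x + inner ℝ (gradient (g i) x) d)
  feas_t : ∀ i, 0 ≤ z i
  u_nonneg : ∀ i, 0 ≤ u i
  v_nonneg : ∀ i, 0 ≤ v i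
  s_nonneg : ∀ i, 0 ≤ s i
  t_nonneg : ∀ i, 0 ≤ t i
  stat_d : ρ • gradient f x + B d + ∑ i, (u i - v i) • gradient (h i) x
    - ∑ i, s i • gradient (g i) x = 0
  stat_y : ∀ i, 1 - u i - v i = 0
  stat_z : ∀ i, 1 - s i - t i = 0
  compl_u : ∀ i, u i * (y i - (h i x + inner ℝ (gradient (h i) x) d)) = 0
  compl_v : ∀ i, v i * (y i + (h i x + inner ℝ (gradient (h i) x) d)) = 0
  compl_s : ∀ i, s i * (z i + (g i x + inner ℝ (gradient (g i) x) d)) = 0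
  compl_t : ∀ i, t i * z i = 0

/-- One full SQP step with parameter `ρ` from `(x, u, v, s)`: the new point is `x' = x + d`, where
`d` solves (in the KKT sense) the quadratic program at `x` with the exact Lagrangian Hessian, and
`(u', v', s', t')` are the multipliers of that quadratic program. -/
def IsSQPStep {n mE mI : ℕ} (f : Vec n → ℝ) (h : Fin mE → Vec n → ℝ)
    (g : Fin mI → Vec n → ℝ) (ρ : ℝ) (x : Vec n) (u v : Vec mE) (s : Vec mI)
    (x' : Vec n) (u' v' : Vec mE) (s' t' : Vec mI) : Prop :=
  ∃ (d : Vec n) (y : Vec mE) (z : Vec mI), x' = x + d ∧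
    IsQPKKT f h g ρ x (lagrangianHess f h g ρ x (u - v) s) d y z u' v' s' t'

/-- The vector `μ*`: `sign (hᵢ(a))` where `hᵢ(a) ≠ 0`, and `uᵢ - vᵢ` where `hᵢ(a) = 0`. -/
def muStar {n mE : ℕ} (h : Fin mE → Vec n → ℝ) (a : Vec n) (u v : Vec mE) : Vec mE :=
  WithLp.toLp 2 fun i => if h i a = 0 then u i - v i else Real.sign (h i a)

/-- The vector `lam*`: `1` where `gᵢ(a) < 0`, `sᵢ` where `gᵢ(a) = 0`, `0` where `gᵢ(a) > 0`. -/
def lamStar {n mI : ℕ} (g : Fin mI → Vec n → ℝ) (a : Vec n) (s : Vec mI) : Vec mI :=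
  WithLp.toLp 2 fun i => if g i a < 0 then 1 else if g i a = 0 then s i else 0

/-- The gradients of the constraints that vanish at `a` are linearly independent. -/
def LICQ {n mE mI : ℕ} (h : Fin mE → Vec n → ℝ) (g : Fin mI → Vec n → ℝ) (a : Vec n) : Prop :=
  LinearIndependent ℝ (Sum.elim
    (fun i : {i : Fin mE // h i a = 0} => gradient (h i) a)
    (fun i : {i : Fin mI // g i a = 0} => gradient (g i) a))

end LeastViolation

end

/-!
# Local convergence of full SQP steps to a DZ-stationary point

The argument is Newton's method on the optimality system at the limit.

*Active set.* In the limit the linearized constraints take the values of the constraints, so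
complementarity in the quadratic program fixes the multipliers of the inactive constraints to
`muStar` and `lamStar` after finitely many steps (`eventually_sub_eq_muStar`,
`eventually_eq_lamStar`). The multipliers of the active constraints converge to values strictly
inside their range, and complementarity then makes the linearizations of these constraints vanish
(`IsQPKKT.linearization_eq_zero_of_sub_mem_Ioo`, `IsQPKKT.linearization_eq_zero_of_mem_Ioo`).

*Stationarity.* Passing to the limit in the stationarity equation, the objective drops out since
`ρ k → 0`, and the constraint gradients balance (`balance_of_tendsto`). Because `|muStar| ≤ 1` and
`0 ≤ lamStar ≤ 1`, the function `∑ muStar i * h i - ∑ lamStar i * g i` is a minorant of the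
violation measure touching it at the limit, and its derivative there is zero
(`isDZStationary_of_balance`).

*Rate.* Let `r k` be the distance of the `k`-th primal-dual iterate to the limit. Taylor expansion
shows that the KKT matrix at the limit maps the new error vector to a residual of order
`ρ k + r k ^ 2 + r k * r (k + 1)` (`newton_stationarity_error_isBigO`,
`newton_feasibility_error_isBigO`). This matrix is injective by linear independence of the active
gradients and the second-order condition (`kktMatrix_injective`), hence bounded below, so
`r (k + 1)` has the same order. As `r k → 0`, the mixed product is absorbed on the left
(`eventually_le_of_isBigO_mul_self`).
-/

namespace LeastViolation

/-! ### Taylor estimates -/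

/-- First-order Taylor estimate at `a` with quadratic remainder, when the derivative is
calm (Lipschitz relative to the single point `a`). -/
theorem taylor_isBigO_of_calm_fderiv {E F : Type*} [NormedAddCommGroup E] [NormedSpace ℝ E]
    [NormedAddCommGroup F] [NormedSpace ℝ F] {φ : E → F} {a : E}
    (hφ : Differentiable ℝ φ)
    (hlip : (fun y => fderiv ℝ φ y - fderiv ℝ φ a) =O[𝓝 a] fun y => y - a) :
    (fun y => φ y - φ a - fderiv ℝ φ a (y - a)) =O[𝓝 a] fun y => ‖y - a‖ ^ 2 := by
  obtain ⟨C, hC0, hC⟩ := hlip.exists_nonneg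
  obtain ⟨δ, hδ, hball⟩ := Metric.eventually_nhds_iff_ball.1 hC.bound
  refine IsBigO.of_bound C ?_
  filter_upwards [Metric.ball_mem_nhds a hδ] with y hy
  have key := (convex_segment a y).norm_image_sub_le_of_norm_fderiv_le'
    (𝕜 := ℝ) (f := φ) (φ := fderiv ℝ φ a) (C := C * ‖y - a‖) (fun z _ => hφ z)
    (fun z hz => by
      have hz' : ‖z - a‖ ≤ ‖y - a‖ := by
        simpa [dist_eq_norm, norm_sub_rev] using (norm_sub_le_of_mem_segment hz)
      have hzb : z ∈ Metric.ball a δ := by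
        rw [mem_ball_iff_norm] at hy ⊢; exact hz'.trans_lt hy
      exact (hball z hzb).trans (by gcongr))
    (left_mem_segment ℝ a y) (right_mem_segment ℝ a y)
  calc ‖φ y - φ a - fderiv ℝ φ a (y - a)‖ ≤ C * ‖y - a‖ * ‖y - a‖ := key
    _ = C * ‖‖y - a‖ ^ 2‖ := by rw [norm_pow, norm_norm]; ring

theorem fderiv_eq_inner_gradient {n : ℕ} {φ : Vec n → ℝ} (y d : Vec n) :
    fderiv ℝ φ y d = inner ℝ (gradient φ y) d := by
  simp [gradient]

namespace SmoothNear

variable {n : ℕ} {φ : Vec n → ℝ} {a : Vec n}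

theorem contDiff_gradient (hφ : SmoothNear φ a) : ContDiff ℝ 1 (gradient φ) := by
  have h1 : ContDiff ℝ 1 (fderiv ℝ φ) := hφ.1.fderiv_right (by norm_num)
  exact (InnerProductSpace.toDual ℝ (Vec n)).symm.contDiff.comp h1

theorem continuous_hess (hφ : SmoothNear φ a) : Continuous (hess φ) :=
  hφ.contDiff_gradient.continuous_fderiv (by norm_num)

theorem hess_sub_isBigO (hφ : SmoothNear φ a) :
    (fun y => hess φ y - hess φ a) =O[𝓝 a] fun y => y - a := by
  obtain ⟨K, U, hU, hK⟩ := hφ.2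
  refine IsBigO.of_bound K ?_
  filter_upwards [hU] with y hy
  exact hK.norm_sub_le hy (mem_of_mem_nhds hU)

theorem gradient_sub_isBigO (hφ : SmoothNear φ a) :
    (fun y => gradient φ y - gradient φ a) =O[𝓝 a] fun y => y - a :=
  ((hφ.contDiff_gradient.differentiable (by norm_num)) a).isBigO_sub

theorem gradient_taylor_isBigO (hφ : SmoothNear φ a) :
    (fun y => gradient φ y - gradient φ a - hess φ a (y - a)) =O[𝓝 a] fun y => ‖y - a‖ ^ 2 :=
  taylor_isBigO_of_calm_fderiv (hφ.contDiff_gradient.differentiable (by norm_num))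
    hφ.hess_sub_isBigO

theorem taylor_isBigO (hφ : SmoothNear φ a) :
    (fun y => φ y - φ a - inner ℝ (gradient φ a) (y - a)) =O[𝓝 a] fun y => ‖y - a‖ ^ 2 := by
  simp only [← fderiv_eq_inner_gradient]
  refine taylor_isBigO_of_calm_fderiv (hφ.1.differentiable (by norm_num)) ?_
  refine ((hφ.1.fderiv_right (m := 1) (by norm_num)).differentiable (by norm_num) a).isBigO_sub

end SmoothNear

/-! ### Complementarity in the quadratic program -/

namespace IsQPKKT

variable {n mE mI : ℕ} {f : Vec n → ℝ} {h : Fin mE → Vec n → ℝ} {g : Fin mI → Vec n → ℝ}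
  {ρ : ℝ} {x : Vec n} {B : Vec n →L[ℝ] Vec n} {d : Vec n} {y : Vec mE} {z : Vec mI}
  {u v : Vec mE} {s t : Vec mI}

/-- Where the linearization is positive, the constraint with multiplier `v i` is slack, so that
`v i = 0`, and `u i + v i = 1` leaves `u i = 1`. -/
theorem sub_eq_one_of_pos (H : IsQPKKT f h g ρ x B d y z u v s t) {i : Fin mE}
    (hi : 0 < h i x + inner ℝ (gradient (h i) x) d) : u i - v i = 1 := by
  have hv : v i = 0 := (mul_eq_zero.1 (H.compl_v i)).resolve_right
    (by linarith [H.feas_u i])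
  linarith [H.stat_y i]

theorem sub_eq_neg_one_of_neg (H : IsQPKKT f h g ρ x B d y z u v s t) {i : Fin mE}
    (hi : h i x + inner ℝ (gradient (h i) x) d < 0) : u i - v i = -1 := by
  have hu : u i = 0 := (mul_eq_zero.1 (H.compl_u i)).resolve_right
    (by linarith [H.feas_v i])
  linarith [H.stat_y i]

theorem eq_one_of_neg (H : IsQPKKT f h g ρ x B d y z u v s t) {i : Fin mI}
    (hi : g i x + inner ℝ (gradient (g i) x) d < 0) : s i = 1 := by
  have ht : t i = 0 := (mul_eq_zero.1 (H.compl_t i)).resolve_right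
    (by linarith [H.feas_s i])
  linarith [H.stat_z i]

theorem eq_zero_of_pos (H : IsQPKKT f h g ρ x B d y z u v s t) {i : Fin mI}
    (hi : 0 < g i x + inner ℝ (gradient (g i) x) d) : s i = 0 :=
  (mul_eq_zero.1 (H.compl_s i)).resolve_right (by linarith [H.feas_t i])

/-- If neither `u i` nor `v i` vanishes, both constraints `y i ≥ ±c` on the linearization `c` are
tight, which forces `c = 0`. -/
theorem linearization_eq_zero_of_sub_mem_Ioo (H : IsQPKKT f h g ρ x B d y z u v s t) {i : Fin mE}
    (hi : u i - v i ∈ Set.Ioo (-1 : ℝ) 1) : h i x + inner ℝ (gradient (h i) x) d = 0 := by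
  have hsum := H.stat_y i
  have h1 := (mul_eq_zero.1 (H.compl_u i)).resolve_left (by linarith [hi.1])
  have h2 := (mul_eq_zero.1 (H.compl_v i)).resolve_left (by linarith [hi.2])
  linarith

theorem linearization_eq_zero_of_mem_Ioo (H : IsQPKKT f h g ρ x B d y z u v s t) {i : Fin mI}
    (hi : s i ∈ Set.Ioo (0 : ℝ) 1) : g i x + inner ℝ (gradient (g i) x) d = 0 := by
  have hsum := H.stat_z i
  have h1 := (mul_eq_zero.1 (H.compl_s i)).resolve_left (by linarith [hi.1])
  have h2 := (mul_eq_zero.1 (H.compl_t i)).resolve_left (by linarith [hi.2])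
  linarith

end IsQPKKT

/-! ### The violation measure near a point with balanced gradients -/

/-- A function with a differentiable minorant that touches it at `a` with zero derivative is
stationary at `a`. -/
theorem isStationaryFor_of_minorant {n : ℕ} {c φ : Vec n → ℝ} {a : Vec n}
    (hle : ∀ y, φ y ≤ c y) (heq : φ a = c a) (hφ : HasFDerivAt φ (0 : Vec n →L[ℝ] ℝ) a) :
    IsStationaryFor c a := by
  intro d ε hε
  have hl : HasDerivAt (fun t : ℝ => φ (a + t • d)) 0 0 := by
    have hline : HasDerivAt (fun t : ℝ => a + t • d) d 0 := by
      simpa using ((hasDerivAt_id (0 : ℝ)).smul_const d).const_add a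
    have hφ' : HasFDerivAt φ (0 : Vec n →L[ℝ] ℝ) (a + (0 : ℝ) • d) := by simpa using hφ
    exact hφ'.comp_hasDerivAt (0 : ℝ) hline
  have hlim := (hasDerivAt_iff_tendsto_slope_zero.1 hl).mono_left
    (nhdsWithin_mono (0 : ℝ) (fun t (ht : 0 < t) => ht.ne'))
  filter_upwards [hlim.eventually (lt_mem_nhds (neg_lt_zero.2 hε)), self_mem_nhdsWithin]
    with t ht ht0
  have ht0 : 0 < t := ht0
  refine ht.le.trans ?_
  simp only [zero_add, zero_smul, add_zero, smul_eq_mul]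
  rw [div_eq_inv_mul, heq]
  gcongr
  exact hle _

variable {n mE mI : ℕ} {h : Fin mE → Vec n → ℝ} {g : Fin mI → Vec n → ℝ} {a : Vec n}
  {u v : Vec mE} {s : Vec mI}

theorem muStar_mul_self (i : Fin mE) : muStar h a u v i * h i a = |h i a| := by
  rcases lt_trichotomy (h i a) 0 with hi | hi | hi
  · simp [muStar, hi.ne, Real.sign_of_neg hi, abs_of_neg hi]
  · simp [hi]
  · simp [muStar, hi.ne', Real.sign_of_pos hi, abs_of_pos hi]

theorem lamStar_mul_self (i : Fin mI) : lamStar g a s i * g i a = -max 0 (-(g i a)) := by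
  rcases lt_trichotomy (g i a) 0 with hi | hi | hi
  · simp [lamStar, hi, hi.le]
  · simp [hi]
  · simp [lamStar, hi.not_gt, hi.ne', hi.le]

theorem abs_muStar_le_one {i : Fin mE}
    (huv : h i a = 0 → u i ∈ Set.Ioo (0 : ℝ) 1 ∧ v i ∈ Set.Ioo (0 : ℝ) 1) :
    |muStar h a u v i| ≤ 1 := by
  rcases lt_trichotomy (h i a) 0 with hi | hi | hi
  · simp [muStar, hi.ne, Real.sign_of_neg hi]
  · obtain ⟨⟨h1, h2⟩, h3, h4⟩ := huv hi
    simp only [muStar, hi, if_true]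
    rw [abs_le]; constructor <;> linarith
  · simp [muStar, hi.ne', Real.sign_of_pos hi]

theorem lamStar_mem_Icc {i : Fin mI} (hs : g i a = 0 → s i ∈ Set.Ioo (0 : ℝ) 1) :
    lamStar g a s i ∈ Set.Icc (0 : ℝ) 1 := by
  rcases lt_trichotomy (g i a) 0 with hi | hi | hi
  · simp [lamStar, hi]
  · simpa [lamStar, hi] using Set.Ioo_subset_Icc_self (hs hi)
  · simp [lamStar, hi.not_gt, hi.ne']

/-- If the gradients balance with the multipliers `muStar`, `lamStar`, then the point is
DZ-stationary: the function `∑ muStar i * h i - ∑ lamStar i * g i` lies below the violation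
measure, touches it at `a` and has vanishing derivative there. -/
theorem isDZStationary_of_balance
    (hh : ∀ i, DifferentiableAt ℝ (h i) a) (hg : ∀ i, DifferentiableAt ℝ (g i) a)
    (huv : ∀ i, h i a = 0 → u i ∈ Set.Ioo (0 : ℝ) 1 ∧ v i ∈ Set.Ioo (0 : ℝ) 1)
    (hs : ∀ i, g i a = 0 → s i ∈ Set.Ioo (0 : ℝ) 1)
    (hbal : ∑ i, muStar h a u v i • gradient (h i) a
      - ∑ i, lamStar g a s i • gradient (g i) a = 0) :
    IsDZStationary h g a := by
  refine ⟨?_, -muStar h a u v, lamStar g a s, fun i => (lamStar_mem_Icc (hs i)).1, ?_, ?_,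
    lamStar_mul_self⟩
  · refine isStationaryFor_of_minorant
      (φ := fun y => ∑ i, muStar h a u v i * h i y - ∑ i, lamStar g a s i * g i y) ?_ ?_ ?_
    · intro y
      rw [violation, sub_eq_add_neg, ← Finset.sum_neg_distrib]
      refine add_le_add (Finset.sum_le_sum fun i _ => ?_) (Finset.sum_le_sum fun i _ => ?_)
      · calc muStar h a u v i * h i y ≤ |muStar h a u v i| * |h i y| := by
              rw [← abs_mul]; exact le_abs_self _
          _ ≤ 1 * |h i y| := by gcongr; exact abs_muStar_le_one (huv i)
          _ = |h i y| := one_mul _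
      · obtain ⟨h0, h1⟩ := lamStar_mem_Icc (hs i)
        calc -(lamStar g a s i * g i y) = lamStar g a s i * -(g i y) := by ring
          _ ≤ lamStar g a s i * max 0 (-(g i y)) := by gcongr; exact le_max_right _ _
          _ ≤ 1 * max 0 (-(g i y)) := by gcongr
          _ = _ := one_mul _
    · simp only [violation, muStar_mul_self, lamStar_mul_self, Finset.sum_neg_distrib,
        sub_neg_eq_add]
    · have h1 : HasFDerivAt
          (fun y => ∑ i, muStar h a u v i * h i y - ∑ i, lamStar g a s i * g i y)
          (∑ i, muStar h a u v i • fderiv ℝ (h i) a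
            - ∑ i, lamStar g a s i • fderiv ℝ (g i) a) a :=
        (HasFDerivAt.fun_sum fun i _ => (hh i).hasFDerivAt.const_mul _).sub
          (HasFDerivAt.fun_sum fun i _ => (hg i).hasFDerivAt.const_mul _)
      convert h1 using 1
      ext d
      have := congrArg (fun z => inner ℝ z d) hbal
      simp only [inner_sub_left, sum_inner, inner_smul_left, inner_zero_left] at this
      simp only [zero_apply, sub_apply, sum_apply, smul_apply, smul_eq_mul,
        fderiv_eq_inner_gradient]
      simpa using this.symm
  · rw [← hbal]
    simp only [PiLp.neg_apply, neg_smul, Finset.sum_neg_distrib, neg_neg]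
  · intro i
    rw [PiLp.neg_apply, neg_mul, muStar_mul_self]

/-! ### The KKT matrix -/

/-- The space `ℝ^(n + mE + mI)` of stacked primal-dual vectors. -/
abbrev StackedVec (n mE mI : ℕ) := EuclideanSpace ℝ (Fin n ⊕ (Fin mE ⊕ Fin mI))

/-- The primal part of a stacked vector `(x, μ, lam)`. -/
def primalPart : StackedVec n mE mI →ₗ[ℝ] Vec n where
  toFun w := WithLp.toLp 2 fun i => w (Sum.inl i)
  map_add' _ _ := rfl
  map_smul' _ _ := rfl

@[simp] theorem primalPart_stack (x : Vec n) (μ : Vec mE) (lam : Vec mI) :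
    primalPart (stack x μ lam) = x := rfl

@[simp] theorem stack_inr_inl (x : Vec n) (μ : Vec mE) (lam : Vec mI) (i : Fin mE) :
    stack x μ lam (Sum.inr (Sum.inl i)) = μ i := rfl

@[simp] theorem stack_inr_inr (x : Vec n) (μ : Vec mE) (lam : Vec mI) (i : Fin mI) :
    stack x μ lam (Sum.inr (Sum.inr i)) = lam i := rfl

theorem norm_primalPart_le (w : StackedVec n mE mI) : ‖primalPart w‖ ≤ ‖w‖ := by
  rw [EuclideanSpace.norm_eq, EuclideanSpace.norm_eq]
  refine Real.sqrt_le_sqrt ?_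
  rw [Fintype.sum_sum_type]
  exact le_add_of_nonneg_right (Finset.sum_nonneg fun i _ => by positivity)

/-- The KKT matrix of the equality-constrained quadratic program given by the constraints active
at `a`, with Hessian `B`. It acts on all of `ℝ^(n + mE + mI)`: in the row of an inactive
constraint it returns the multiplier itself, so that the inactive multipliers need not be
eliminated. -/
noncomputable def kktMatrix (h : Fin mE → Vec n → ℝ) (g : Fin mI → Vec n → ℝ) (a : Vec n)
    (B : Vec n →L[ℝ] Vec n) :
    StackedVec n mE mI →ₗ[ℝ] Vec n × (Fin mE → ℝ) × (Fin mI → ℝ) where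
  toFun w :=
    (B (primalPart w) + ∑ i, w (Sum.inr (Sum.inl i)) • gradient (h i) a
      - ∑ i, w (Sum.inr (Sum.inr i)) • gradient (g i) a,
     fun i => if h i a = 0 then inner ℝ (gradient (h i) a) (primalPart w)
       else w (Sum.inr (Sum.inl i)),
     fun i => if g i a = 0 then inner ℝ (gradient (g i) a) (primalPart w)
       else w (Sum.inr (Sum.inr i)))
  map_add' w₁ w₂ := by
    refine Prod.ext ?_ (Prod.ext (funext fun i => ?_) (funext fun i => ?_))
    · simp only [map_add, PiLp.add_apply, add_smul, Finset.sum_add_distrib, Prod.fst_add]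
      abel
    · by_cases hi : h i a = 0 <;> simp [hi, inner_add_right]
    · by_cases hi : g i a = 0 <;> simp [hi, inner_add_right]
  map_smul' c w := by
    refine Prod.ext ?_ (Prod.ext (funext fun i => ?_) (funext fun i => ?_))
    · simp [smul_sub, smul_add, Finset.smul_sum, mul_smul]
    · by_cases hi : h i a = 0 <;> simp [hi, inner_smul_right]
    · by_cases hi : g i a = 0 <;> simp [hi, inner_smul_right]

theorem sum_subtype_of_eq_zero {ι M : Type*} [Fintype ι] [AddCommMonoid M] {p : ι → Prop}
    [DecidablePred p] {F : ι → M} (hF : ∀ i, ¬p i → F i = 0) :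
    ∑ i : {i // p i}, F i = ∑ i, F i := by
  rw [← Fintype.sum_subtype_add_sum_subtype p F,
    Finset.sum_eq_zero (s := Finset.univ (α := {i // ¬p i})) fun i _ => hF i i.2, add_zero]

/-- The KKT matrix is nonsingular under linear independence of the active gradients and positive
curvature of `B` on their common kernel. -/
theorem kktMatrix_injective {B : Vec n →L[ℝ] Vec n} (hlicq : LICQ h g a)
    (hB : ∀ d : Vec n, d ≠ 0 → (∀ i, h i a = 0 → inner ℝ (gradient (h i) a) d = 0) →
      (∀ i, g i a = 0 → inner ℝ (gradient (g i) a) d = 0) → 0 < inner ℝ d (B d)) :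
    Function.Injective (kktMatrix h g a B) := by
  rw [injective_iff_map_eq_zero]
  intro w hw
  have h1 : B (primalPart w) + ∑ i, w (Sum.inr (Sum.inl i)) • gradient (h i) a
      - ∑ i, w (Sum.inr (Sum.inr i)) • gradient (g i) a = 0 := congrArg Prod.fst hw
  have h2 : ∀ i, (if h i a = 0 then inner ℝ (gradient (h i) a) (primalPart w)
       else w (Sum.inr (Sum.inl i))) = 0 := congrFun (congrArg (fun p => p.2.1) hw)
  have h3 : ∀ i, (if g i a = 0 then inner ℝ (gradient (g i) a) (primalPart w)
       else w (Sum.inr (Sum.inr i))) = 0 := congrFun (congrArg (fun p => p.2.2) hw)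
  have h2a : ∀ i, h i a = 0 → inner ℝ (gradient (h i) a) (primalPart w) = 0 :=
    fun i hi => by simpa [hi] using h2 i
  have h3a : ∀ i, g i a = 0 → inner ℝ (gradient (g i) a) (primalPart w) = 0 :=
    fun i hi => by simpa [hi] using h3 i
  have h2b : ∀ i, h i a ≠ 0 → w (Sum.inr (Sum.inl i)) = 0 :=
    fun i hi => by simpa [hi] using h2 i
  have h3b : ∀ i, g i a ≠ 0 → w (Sum.inr (Sum.inr i)) = 0 :=
    fun i hi => by simpa [hi] using h3 i
  -- pairing the first row with the primal part annihilates all gradient terms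
  have hx : primalPart w = 0 := by
    by_contra hne
    have hpos := hB _ hne h2a h3a
    have hin := congrArg (fun z => inner ℝ (primalPart w) z) h1
    simp only [inner_sub_right, inner_add_right, inner_sum, inner_smul_right,
      inner_zero_right] at hin
    rw [Finset.sum_eq_zero (s := Finset.univ (α := Fin mE)), Finset.sum_eq_zero] at hin
    · linarith
    · intro i _
      by_cases hi : g i a = 0
      · rw [real_inner_comm, h3a i hi, mul_zero]
      · rw [h3b i hi, zero_mul]
    · intro i _
      by_cases hi : h i a = 0
      · rw [real_inner_comm, h2a i hi, mul_zero]
      · rw [h2b i hi, zero_mul]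
  have hmul := Fintype.linearIndependent_iff.1 hlicq
    (Sum.elim (fun i => w (Sum.inr (Sum.inl i.1))) (fun i => -w (Sum.inr (Sum.inr i.1)))) (by
      rw [hx, map_zero, zero_add] at h1
      rw [Fintype.sum_sum_type]
      simp only [Sum.elim_inl, Sum.elim_inr, neg_smul, Finset.sum_neg_distrib]
      rw [← sub_eq_add_neg, ← h1]
      congr 1
      · exact sum_subtype_of_eq_zero
          (F := fun i => w (Sum.inr (Sum.inl i)) • gradient (h i) a)
          fun i hi => by rw [h2b i hi, zero_smul]
      · exact sum_subtype_of_eq_zero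
          (F := fun i => w (Sum.inr (Sum.inr i)) • gradient (g i) a)
          fun i hi => by rw [h3b i hi, zero_smul])
  ext j
  rcases j with j | j | j
  · exact congrArg (fun z : Vec n => z j) hx
  · by_cases hj : h j a = 0
    · exact hmul (Sum.inl ⟨j, hj⟩)
    · exact h2b j hj
  · by_cases hj : g j a = 0
    · exact neg_eq_zero.1 (hmul (Sum.inr ⟨j, hj⟩))
    · exact h3b j hj

/-! ### Residual estimates for one Newton step -/

section Residual

variable {φ : Vec n → ℝ} {x x' : ℕ → Vec n} {m m' r r' G : ℕ → ℝ} {m₀ : ℝ}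

/-- The contribution of one constraint `φ`, with multipliers `m` before and `m'` after the step, to
the error made when the stationarity equation of the step from `x` to `x'` is replaced by its
linearization at the limit `(a, m₀)`. Here `r` and `r'` measure the distance to the limit before
and after the step. -/
theorem newton_stationarity_error_isBigO (hφ : SmoothNear φ a)
    (hx : Tendsto x atTop (𝓝 a)) (hr' : Tendsto r' atTop (𝓝 0))
    (hr : Tendsto r atTop (𝓝 0))
    (hxr : (fun k => x k - a) =O[atTop] r) (hxr' : (fun k => x' k - a) =O[atTop] r')
    (hm : (fun k => m k - m₀) =O[atTop] r) (hm' : (fun k => m' k - m₀) =O[atTop] r')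
    (hG : (fun k => r k ^ 2) =O[atTop] G) (hG' : (fun k => r k * r' k) =O[atTop] G) :
    (fun k => m₀ • hess φ a (x' k - a) + m' k • gradient φ a
      - m k • hess φ (x k) (x' k - x k) - m' k • gradient φ (x k)) =O[atTop] G := by
  -- only the products `r * r` and `r * r'` occur, as the step length is at most `r + r'`
  have hbdd : ∀ {q p : ℕ → ℝ}, Tendsto p atTop (𝓝 0) → (fun k => q k - m₀) =O[atTop] p →
      q =O[atTop] fun _ => (1 : ℝ) := fun hp hq => by
    simpa using (hq.trans (hp.isBigO_one ℝ)).add (isBigO_const_const m₀ one_ne_zero atTop)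
  have hd : (fun k => r k * ‖x' k - x k‖) =O[atTop] G := by
    have h1 : (fun k => r k * ‖x' k - a‖) =O[atTop] G :=
      ((isBigO_refl r atTop).mul hxr'.norm_left).trans hG'
    have h2 : (fun k => r k * ‖x k - a‖) =O[atTop] G :=
      ((isBigO_refl r atTop).mul hxr.norm_left).trans (by simpa only [sq] using hG)
    refine (IsBigO.of_bound 1 (Eventually.of_forall fun k => ?_)).trans
      (h1.norm_left.add h2.norm_left)
    simp only [norm_mul, norm_norm]
    rw [one_mul, ← mul_add, norm_mul, norm_norm,
      Real.norm_of_nonneg (add_nonneg (norm_nonneg _) (norm_nonneg _))]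
    gcongr
    simpa only [norm_sub_rev a] using norm_sub_le_norm_sub_add_norm_sub (x' k) a (x k)
  have hclm : ∀ (T : ℕ → Vec n →L[ℝ] Vec n) (z : ℕ → Vec n),
      (fun k => T k (z k)) =O[atTop] fun k => ‖T k‖ * ‖z k‖ := fun T z =>
    IsBigO.of_bound 1 (Eventually.of_forall fun k => by
      simpa using (T k).le_opNorm (z k))
  have t1 : (fun k => m' k • (gradient φ (x k) - gradient φ a - hess φ a (x k - a)))
      =O[atTop] G := by
    have := (hbdd hr' hm').smul
      ((hφ.gradient_taylor_isBigO.comp_tendsto hx).trans (hxr.norm_left.pow 2))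
    exact (this.congr_right fun k => by simp).trans hG
  have t2 : (fun k => (m' k - m₀) • hess φ a (x k - a)) =O[atTop] G := by
    have := hm'.smul (((hess φ a).isBigO_comp (fun k => x k - a) atTop).trans hxr)
    exact (this.congr_right fun k => by simp [mul_comm]).trans hG'
  have t3 : (fun k => (m k - m₀) • hess φ a (x' k - x k)) =O[atTop] G := by
    have := hm.smul ((hess φ a).isBigO_comp (fun k => x' k - x k) atTop).norm_right
    exact (this.congr_right fun k => by simp).trans hd
  have t4 : (fun k => m k • (hess φ (x k) - hess φ a) (x' k - x k)) =O[atTop] G := by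
    have h1 : (fun k => hess φ (x k) - hess φ a) =O[atTop] r :=
      (hφ.hess_sub_isBigO.comp_tendsto hx).trans hxr
    have h2 := (hclm (fun k => hess φ (x k) - hess φ a) (fun k => x' k - x k)).trans
      (h1.norm_left.mul (isBigO_refl (fun k => ‖x' k - x k‖) atTop))
    have := (hbdd hr hm).smul h2
    exact (this.congr_right fun k => by simp).trans hd
  -- the error is minus the sum of these four terms, by `x' - a = (x' - x) + (x - a)`
  refine (((t1.add t2).add t3).add t4).neg_left.congr_left fun k => ?_
  have e : x' k - a = (x' k - x k) + (x k - a) := by abel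
  rw [e]
  simp only [map_add, sub_apply, smul_sub, sub_smul, smul_add]
  abel

/-- If the linearization of `φ` at `x` vanishes at `x'`, and `φ` vanishes at the limit `a`, then
`x' - a` is nearly orthogonal to the gradient at `a`. -/
theorem newton_feasibility_error_isBigO (hφ : SmoothNear φ a) (ha : φ a = 0)
    (hx : Tendsto x atTop (𝓝 a))
    (hlin : ∀ᶠ k in atTop, φ (x k) + inner ℝ (gradient φ (x k)) (x' k - x k) = 0)
    (hxr : (fun k => x k - a) =O[atTop] r) (hxr' : (fun k => x' k - a) =O[atTop] r')
    (hG : (fun k => r k ^ 2) =O[atTop] G) (hG' : (fun k => r k * r' k) =O[atTop] G) :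
    (fun k => inner ℝ (gradient φ a) (x' k - a)) =O[atTop] G := by
  have hinner : ∀ {p q : ℕ → Vec n} {α β : ℕ → ℝ}, p =O[atTop] α → q =O[atTop] β →
      (fun k => (inner ℝ (p k) (q k) : ℝ)) =O[atTop] fun k => α k * β k := fun hp hq =>
    (IsBigO.of_bound 1 (Eventually.of_forall fun k => by
      simpa using norm_inner_le_norm (𝕜 := ℝ) _ _)).trans (hp.norm_left.mul hq.norm_left)
  have hgrad : (fun k => gradient φ (x k) - gradient φ a) =O[atTop] r :=
    (hφ.gradient_sub_isBigO.comp_tendsto hx).trans hxr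
  have t1 : (fun k => φ (x k) - φ a - inner ℝ (gradient φ a) (x k - a)) =O[atTop] G :=
    ((hφ.taylor_isBigO.comp_tendsto hx).trans (hxr.norm_left.pow 2)).trans hG
  have t2 := (hinner hgrad hxr').trans hG'
  have t3 := (hinner hgrad hxr).trans (by simpa only [sq] using hG)
  refine ((t1.add t2).sub t3).neg_left.congr' ?_ EventuallyEq.rfl
  filter_upwards [hlin] with k hk
  rw [ha]
  simp only [inner_sub_left, inner_sub_right] at hk ⊢
  linarith

end Residual

theorem tendsto_clm_apply {T : ℕ → Vec n →L[ℝ] Vec n} {T₀ : Vec n →L[ℝ] Vec n}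
    {z : ℕ → Vec n} {z₀ : Vec n} (hT : Tendsto T atTop (𝓝 T₀)) (hz : Tendsto z atTop (𝓝 z₀)) :
    Tendsto (fun k => T k (z k)) atTop (𝓝 (T₀ z₀)) :=
  ((continuous_fst.clm_apply continuous_snd).tendsto (T₀, z₀)).comp (hT.prodMk_nhds hz)

theorem tendsto_linearization {φ : Vec n → ℝ} (hφ : SmoothNear φ a) {x : ℕ → Vec n}
    (hx : Tendsto x atTop (𝓝 a)) :
    Tendsto (fun k => φ (x k) + inner ℝ (gradient φ (x k)) (x (k + 1) - x k)) atTop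
      (𝓝 (φ a)) := by
  have hd : Tendsto (fun k => x (k + 1) - x k) atTop (𝓝 0) := by
    simpa using (hx.comp (tendsto_add_atTop_nat 1)).sub hx
  simpa using ((hφ.1.continuous.tendsto a).comp hx).add
    (((hφ.contDiff_gradient.continuous.tendsto a).comp hx).inner hd)

/-! ### Consequences of a step -/

/-- Near the limit the signs of the linearized inactive equality constraints are those of the
constraints themselves, which fixes their multipliers. -/
theorem eventually_sub_eq_muStar {f : Vec n → ℝ} {ρ : ℕ → ℝ} {x : ℕ → Vec n}
    {B : ℕ → Vec n →L[ℝ] Vec n} {u' v' : ℕ → Vec mE} {s' t' : ℕ → Vec mI}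
    (hstep : ∀ᶠ k in atTop, ∃ y z, IsQPKKT f h g (ρ k) (x k) (B k) (x (k + 1) - x k) y z
      (u' k) (v' k) (s' k) (t' k))
    (hx : Tendsto x atTop (𝓝 a)) {i : Fin mE} (hh : SmoothNear (h i) a) (hi : h i a ≠ 0) :
    ∀ᶠ k in atTop, u' k i - v' k i = muStar h a u v i := by
  have hlin := tendsto_linearization hh hx
  rcases hi.lt_or_gt with hneg | hpos
  · filter_upwards [hstep, hlin.eventually (gt_mem_nhds hneg)] with k ⟨y, z, hk⟩ hk'
    simp [hk.sub_eq_neg_one_of_neg hk', muStar, hi, Real.sign_of_neg hneg]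
  · filter_upwards [hstep, hlin.eventually (lt_mem_nhds hpos)] with k ⟨y, z, hk⟩ hk'
    simp [hk.sub_eq_one_of_pos hk', muStar, hi, Real.sign_of_pos hpos]

theorem eventually_eq_lamStar {f : Vec n → ℝ} {ρ : ℕ → ℝ} {x : ℕ → Vec n}
    {B : ℕ → Vec n →L[ℝ] Vec n} {u' v' : ℕ → Vec mE} {s' t' : ℕ → Vec mI}
    (hstep : ∀ᶠ k in atTop, ∃ y z, IsQPKKT f h g (ρ k) (x k) (B k) (x (k + 1) - x k) y z
      (u' k) (v' k) (s' k) (t' k))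
    (hx : Tendsto x atTop (𝓝 a)) {i : Fin mI} (hg : SmoothNear (g i) a) (hi : g i a ≠ 0) :
    ∀ᶠ k in atTop, s' k i = lamStar g a s i := by
  have hlin := tendsto_linearization hg hx
  rcases hi.lt_or_gt with hneg | hpos
  · filter_upwards [hstep, hlin.eventually (gt_mem_nhds hneg)] with k ⟨y, z, hk⟩ hk'
    simp [hk.eq_one_of_neg hk', lamStar, hneg]
  · filter_upwards [hstep, hlin.eventually (lt_mem_nhds hpos)] with k ⟨y, z, hk⟩ hk'
    simp [hk.eq_zero_of_pos hk', lamStar, hi, hpos.not_gt]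

/-- The stationarity equation of the quadratic programs passes to the limit. -/
theorem balance_of_tendsto {f : Vec n → ℝ} {ρ : ℕ → ℝ} {x : ℕ → Vec n}
    {p p' : ℕ → Vec mE} {q q' : ℕ → Vec mI} {μ : Vec mE} {lam : Vec mI}
    (hf : SmoothNear f a) (hh : ∀ i, SmoothNear (h i) a) (hg : ∀ i, SmoothNear (g i) a)
    (hρ : Tendsto ρ atTop (𝓝 0)) (hx : Tendsto x atTop (𝓝 a))
    (hp : ∀ i, Tendsto (fun k => p k i) atTop (𝓝 (μ i)))
    (hq : ∀ i, Tendsto (fun k => q k i) atTop (𝓝 (lam i)))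
    (hp' : ∀ i, Tendsto (fun k => p' k i) atTop (𝓝 (μ i)))
    (hq' : ∀ i, Tendsto (fun k => q' k i) atTop (𝓝 (lam i)))
    (hstat : ∀ᶠ k in atTop, ρ k • gradient f (x k)
      + lagrangianHess f h g (ρ k) (x k) (p k) (q k) (x (k + 1) - x k)
      + ∑ i, p' k i • gradient (h i) (x k) - ∑ i, q' k i • gradient (g i) (x k) = 0) :
    ∑ i, μ i • gradient (h i) a - ∑ i, lam i • gradient (g i) a = 0 := by
  have hd : Tendsto (fun k => x (k + 1) - x k) atTop (𝓝 0) := by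
    simpa using (hx.comp (tendsto_add_atTop_nat 1)).sub hx
  have hgr : ∀ {φ : Vec n → ℝ}, SmoothNear φ a →
      Tendsto (fun k => gradient φ (x k)) atTop (𝓝 (gradient φ a)) := fun hφ =>
    (hφ.contDiff_gradient.continuous.tendsto a).comp hx
  have hhe : ∀ {φ : Vec n → ℝ}, SmoothNear φ a →
      Tendsto (fun k => hess φ (x k)) atTop (𝓝 (hess φ a)) := fun hφ =>
    (hφ.continuous_hess.tendsto a).comp hx
  have hBlim : Tendsto (fun k => lagrangianHess f h g (ρ k) (x k) (p k) (q k)) atTop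
      (𝓝 (lagrangianHess f h g 0 a μ lam)) :=
    (hρ.smul (hhe hf)).add ((tendsto_finsetSum _ fun i _ => (hp i).smul (hhe (hh i))).sub
      (tendsto_finsetSum _ fun i _ => (hq i).smul (hhe (hg i))))
  have hlim := (((hρ.smul (hgr hf)).add (tendsto_clm_apply hBlim hd)).add
    (tendsto_finsetSum Finset.univ fun i _ => (hp' i).smul (hgr (hh i)))).sub
    (tendsto_finsetSum Finset.univ fun i _ => (hq' i).smul (hgr (hg i)))
  simpa using tendsto_nhds_unique hlim ((tendsto_congr' hstat).2 tendsto_const_nhds)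

/-- A quantity `r'` that is bounded by `ρ`, `r ^ 2` and the product `r * r'` is bounded by `ρ` and
`r ^ 2` alone, once `r` is small. -/
theorem eventually_le_of_isBigO_mul_self {ρ r r' : ℕ → ℝ} (hρ : ∀ k, 0 ≤ ρ k)
    (hr0 : ∀ k, 0 ≤ r k) (hr0' : ∀ k, 0 ≤ r' k) (hr : Tendsto r atTop (𝓝 0))
    (hO : r' =O[atTop] fun k => ρ k + r k ^ 2 + r k * r' k) :
    ∃ M : ℝ, ∀ᶠ k in atTop, r' k ≤ M * ρ k + M * r k ^ 2 := by
  obtain ⟨C, hC0, hC⟩ := hO.exists_pos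
  -- once `C * r k ≤ 1 / 2`, half of `r' k` absorbs the product term
  refine ⟨2 * C, ?_⟩
  filter_upwards [hC.bound, hr.eventually (gt_mem_nhds (show 0 < 1 / (2 * C) by positivity))]
    with k hk hrk
  have hρk := hρ k
  have h0 := hr0 k
  have h0' := hr0' k
  rw [Real.norm_of_nonneg h0', Real.norm_of_nonneg (by positivity)] at hk
  have h1 : C * r k ≤ 1 / 2 := by
    rw [lt_div_iff₀ (by positivity)] at hrk
    linarith
  have h2 : C * r k * r' k ≤ 1 / 2 * r' k := by gcongr
  linarith

end LeastViolation

/-! ### Stationarity of the limit and rate of convergence -/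

open LeastViolation

theorem mainTheorem3 {n mE mI : ℕ}
    (f : LeastViolation.Vec n → ℝ)
    (h : Fin mE → LeastViolation.Vec n → ℝ)
    (g : Fin mI → LeastViolation.Vec n → ℝ)
    (xs : LeastViolation.Vec n)
    (us vs : LeastViolation.Vec mE) (ss : LeastViolation.Vec mI)
    (ρ : ℕ → ℝ)
    (x : ℕ → LeastViolation.Vec n)
    (u v : ℕ → LeastViolation.Vec mE) (s t : ℕ → LeastViolation.Vec mI)
    (w : ℕ → EuclideanSpace ℝ (Fin n ⊕ (Fin mE ⊕ Fin mI)))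
    (ws : EuclideanSpace ℝ (Fin n ⊕ (Fin mE ⊕ Fin mI)))
    -- the primal-dual iterates and their limit
    (hw : ∀ k, w k = LeastViolation.stack (x k) (u k - v k) (s k))
    (hws : ws = LeastViolation.stack xs (LeastViolation.muStar h xs us vs)
      (LeastViolation.lamStar g xs ss))
    -- smoothness of the problem functions
    (hf : LeastViolation.SmoothNear f xs)
    (hh : ∀ i, LeastViolation.SmoothNear (h i) xs)
    (hg : ∀ i, LeastViolation.SmoothNear (g i) xs)
    -- eventually the iterates are generated by full SQP steps
    (hρ : ∀ k, 0 < ρ k)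
    (hstep : ∀ᶠ k in atTop, LeastViolation.IsSQPStep f h g (ρ k) (x k) (u k) (v k) (s k)
      (x (k + 1)) (u (k + 1)) (v (k + 1)) (s (k + 1)) (t (k + 1)))
    -- convergence
    (hwlim : Tendsto w atTop (𝓝 ws))
    (hρlim : Tendsto ρ atTop (𝓝 0))
    -- linear independence of the active gradients
    (hlicq : LeastViolation.LICQ h g xs)
    -- strict complementarity
    (huv : ∀ i, h i xs = 0 → us i ∈ Set.Ioo (0 : ℝ) 1 ∧ vs i ∈ Set.Ioo (0 : ℝ) 1)
    (hs : ∀ i, g i xs = 0 → ss i ∈ Set.Ioo (0 : ℝ) 1)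
    -- second-order condition
    (hB : ∀ d : LeastViolation.Vec n, d ≠ 0 →
      (∀ i, h i xs = 0 → inner ℝ (gradient (h i) xs) d = 0) →
      (∀ i, g i xs = 0 → inner ℝ (gradient (g i) xs) d = 0) →
      0 < inner ℝ d (LeastViolation.constraintHess h g xs
        (LeastViolation.muStar h xs us vs) (LeastViolation.lamStar g xs ss) d)) :
    LeastViolation.IsDZStationary h g xs ∧
    (∃ M₁ M₂ : ℝ, ∀ᶠ k in atTop,
      ‖w (k + 1) - ws‖ ≤ M₁ * ρ k + M₂ * ‖w k - ws‖ ^ 2) ∧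
    ((ρ =O[atTop] fun k => ‖w k - ws‖ ^ 2) →
      (fun k => ‖w (k + 1) - ws‖) =O[atTop] fun k => ‖w k - ws‖ ^ 2) ∧
    ((ρ =o[atTop] fun k => ‖w k - ws‖) →
      (fun k => ‖w (k + 1) - ws‖) =o[atTop] fun k => ‖w k - ws‖) := by
  set μs := muStar h xs us vs with hμs
  set ls := lamStar g xs ss with hls
  obtain rfl : w = fun k => stack (x k) (u k - v k) (s k) := funext hw
  subst hws
  set r : ℕ → ℝ := fun k => ‖stack (x k) (u k - v k) (s k) - stack xs μs ls‖ with hr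
  have hr0 : ∀ k, 0 ≤ r k := fun k => norm_nonneg _
  have hrlim : Tendsto r atTop (𝓝 0) := tendsto_iff_norm_sub_tendsto_zero.1 hwlim
  have hrlim' : Tendsto (fun k => r (k + 1)) atTop (𝓝 0) :=
    hrlim.comp (tendsto_add_atTop_nat 1)
  -- each block of the primal-dual vector is controlled by the norm of the whole vector
  have hxr : ∀ k, ‖x k - xs‖ ≤ r k := fun k => by
    simpa using norm_primalPart_le (stack (x k) (u k - v k) (s k) - stack xs μs ls)
  have hμr : ∀ i k, ‖(u k - v k) i - μs i‖ ≤ r k := fun i k => by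
    simpa using PiLp.norm_apply_le (stack (x k) (u k - v k) (s k) - stack xs μs ls)
      (Sum.inr (Sum.inl i))
  have hlr : ∀ i k, ‖s k i - ls i‖ ≤ r k := fun i k => by
    simpa using PiLp.norm_apply_le (stack (x k) (u k - v k) (s k) - stack xs μs ls)
      (Sum.inr (Sum.inr i))
  have hxlim : Tendsto x atTop (𝓝 xs) :=
    tendsto_iff_norm_sub_tendsto_zero.2 (squeeze_zero (fun _ => norm_nonneg _) hxr hrlim)
  have hμlim : ∀ i, Tendsto (fun k => (u k - v k) i) atTop (𝓝 (μs i)) := fun i =>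
    tendsto_iff_norm_sub_tendsto_zero.2 (squeeze_zero (fun _ => norm_nonneg _) (hμr i) hrlim)
  have hllim : ∀ i, Tendsto (fun k => s k i) atTop (𝓝 (ls i)) := fun i =>
    tendsto_iff_norm_sub_tendsto_zero.2 (squeeze_zero (fun _ => norm_nonneg _) (hlr i) hrlim)
  have hO : ∀ {F : Type} [NormedAddCommGroup F] {p : ℕ → F}, (∀ k, ‖p k‖ ≤ r k) →
      p =O[atTop] r := fun hp =>
    IsBigO.of_bound 1 (Eventually.of_forall fun k => by
      rw [one_mul, Real.norm_of_nonneg (hr0 k)]; exact hp k)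
  have hO' : ∀ {F : Type} [NormedAddCommGroup F] {p : ℕ → F}, (∀ k, ‖p k‖ ≤ r k) →
      (fun k => p (k + 1)) =O[atTop] fun k => r (k + 1) := fun hp =>
    (hO hp).comp_tendsto (tendsto_add_atTop_nat 1)
  have hkkt : ∀ᶠ k in atTop, ∃ y z, IsQPKKT f h g (ρ k) (x k)
      (lagrangianHess f h g (ρ k) (x k) (u k - v k) (s k)) (x (k + 1) - x k) y z
      (u (k + 1)) (v (k + 1)) (s (k + 1)) (t (k + 1)) := by
    filter_upwards [hstep] with k ⟨d, y, z, hd, hk⟩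
    exact ⟨y, z, by rwa [hd, add_sub_cancel_left]⟩
  have hstat : ∀ᶠ k in atTop, ρ k • gradient f (x k)
      + lagrangianHess f h g (ρ k) (x k) (u k - v k) (s k) (x (k + 1) - x k)
      + ∑ i, (u (k + 1) - v (k + 1)) i • gradient (h i) (x k)
      - ∑ i, s (k + 1) i • gradient (g i) (x k) = 0 := by
    filter_upwards [hkkt] with k ⟨y, z, hk⟩
    exact hk.stat_d
  have hbal : ∑ i, μs i • gradient (h i) xs - ∑ i, ls i • gradient (g i) xs = 0 :=
    balance_of_tendsto hf hh hg hρlim hxlim hμlim hllim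
      (fun i => (hμlim i).comp (tendsto_add_atTop_nat 1))
      (fun i => (hllim i).comp (tendsto_add_atTop_nat 1)) hstat
  set G : ℕ → ℝ := fun k => ρ k + r k ^ 2 + r k * r (k + 1) with hGdef
  have hGof : ∀ {p : ℕ → ℝ}, (∀ k, 0 ≤ p k) → (∀ k, p k ≤ G k) → p =O[atTop] G := fun h0 hp =>
    IsBigO.of_bound 1 (Eventually.of_forall fun k => by
      rw [one_mul, Real.norm_of_nonneg (h0 k)]; exact (hp k).trans (le_abs_self _))
  have hnn : ∀ k, 0 ≤ r k ^ 2 ∧ 0 ≤ r k * r (k + 1) ∧ 0 ≤ ρ k := fun k =>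
    ⟨sq_nonneg _, mul_nonneg (hr0 _) (hr0 _), (hρ k).le⟩
  have hGρ : ρ =O[atTop] G := hGof (fun k => (hρ k).le) fun k => by
    obtain ⟨h1, h2, h3⟩ := hnn k; simp only [hGdef]; linarith
  have hGr : (fun k => r k ^ 2) =O[atTop] G := hGof (fun k => (hnn k).1) fun k => by
    obtain ⟨h1, h2, h3⟩ := hnn k; simp only [hGdef]; linarith
  have hGr' : (fun k => r k * r (k + 1)) =O[atTop] G := hGof (fun k => (hnn k).2.1) fun k => by
    obtain ⟨h1, h2, h3⟩ := hnn k; simp only [hGdef]; linarith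
  set L := kktMatrix h g xs (constraintHess h g xs μs ls) with hL
  set W : ℕ → StackedVec n mE mI :=
    fun k => stack (x (k + 1)) (u (k + 1) - v (k + 1)) (s (k + 1)) - stack xs μs ls with hW
  -- the objective enters the stationarity equation only with the factor `ρ k`
  have hobj : (fun k => ρ k • gradient f (x k) + ρ k • hess f (x k) (x (k + 1) - x k))
      =O[atTop] G := by
    have hd : Tendsto (fun k => x (k + 1) - x k) atTop (𝓝 0) := by
      simpa using (hxlim.comp (tendsto_add_atTop_nat 1)).sub hxlim
    have h1 := ((hf.contDiff_gradient.continuous.tendsto xs).comp hxlim).add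
      (tendsto_clm_apply ((hf.continuous_hess.tendsto xs).comp hxlim) hd)
    have := (isBigO_refl ρ atTop).smul (h1.isBigO_one ℝ)
    simp only [smul_eq_mul, mul_one, smul_add] at this
    exact this.trans hGρ
  -- the three blocks of rows of the KKT system at the limit
  have hL1 : (fun k => (L (W k)).1) =O[atTop] G := by
    have hsum := ((IsBigO.sum (s := Finset.univ) fun i _ =>
      newton_stationarity_error_isBigO (hh i) hxlim hrlim' hrlim (hO hxr) (hO' hxr)
        (hO (hμr i)) (hO' (hμr i)) hGr hGr').sub
      (IsBigO.sum (s := Finset.univ) fun i _ =>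
      newton_stationarity_error_isBigO (hg i) hxlim hrlim' hrlim (hO hxr) (hO' hxr)
        (hO (hlr i)) (hO' (hlr i)) hGr hGr')).sub hobj
    refine hsum.congr' ?_ EventuallyEq.rfl
    filter_upwards [hstat] with k hk
    -- the difference of the two sides is `hbal - hk`
    rw [← sub_eq_zero]
    refine Eq.trans ?_ ((congrArg₂ (· - ·) hbal hk).trans (sub_zero 0))
    have hLW : (L (W k)).1 = constraintHess h g xs μs ls (x (k + 1) - xs)
        + ∑ i, ((u (k + 1) - v (k + 1)) i - μs i) • gradient (h i) xs
        - ∑ i, (s (k + 1) i - ls i) • gradient (g i) xs := rfl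
    rw [hLW]
    simp only [lagrangianHess, constraintHess, add_apply, sub_apply, smul_apply, sum_apply,
      Finset.sum_apply, sub_smul, Finset.sum_sub_distrib, Finset.sum_add_distrib]
    abel
  have hL2 : ∀ i, (fun k => (L (W k)).2.1 i) =O[atTop] G := fun i => by
    by_cases hi : h i xs = 0
    · have hact : μs i ∈ Set.Ioo (-1 : ℝ) 1 := by
        obtain ⟨⟨h1, h2⟩, h3, h4⟩ := huv i hi
        simp only [hμs, muStar, hi, if_true]
        constructor <;> linarith
      have hlin : ∀ᶠ k in atTop,
          h i (x k) + inner ℝ (gradient (h i) (x k)) (x (k + 1) - x k) = 0 := by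
        filter_upwards [hkkt, ((hμlim i).comp (tendsto_add_atTop_nat 1)).eventually
          (Ioo_mem_nhds hact.1 hact.2)] with k ⟨y, z, hk⟩ hk'
        exact hk.linearization_eq_zero_of_sub_mem_Ioo hk'
      refine (newton_feasibility_error_isBigO (hh i) hi hxlim hlin (hO hxr) (hO' hxr)
        hGr hGr').congr_left fun k => ?_
      simp [hL, hW, kktMatrix, hi]
    -- inactive rows vanish eventually, the multiplier having reached its limit
    · refine (isBigO_zero G atTop).congr' ?_ EventuallyEq.rfl
      filter_upwards [eventually_sub_eq_muStar (u := us) (v := vs) hkkt hxlim (hh i) hi]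
        with k hk
      simp [hL, hW, kktMatrix, hi, hk, hμs]
  have hL3 : ∀ i, (fun k => (L (W k)).2.2 i) =O[atTop] G := fun i => by
    by_cases hi : g i xs = 0
    · have hact : ls i ∈ Set.Ioo (0 : ℝ) 1 := by simpa [hls, lamStar, hi] using hs i hi
      have hlin : ∀ᶠ k in atTop,
          g i (x k) + inner ℝ (gradient (g i) (x k)) (x (k + 1) - x k) = 0 := by
        filter_upwards [hkkt, ((hllim i).comp (tendsto_add_atTop_nat 1)).eventually
          (Ioo_mem_nhds hact.1 hact.2)] with k ⟨y, z, hk⟩ hk'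
        exact hk.linearization_eq_zero_of_mem_Ioo hk'
      refine (newton_feasibility_error_isBigO (hg i) hi hxlim hlin (hO hxr) (hO' hxr)
        hGr hGr').congr_left fun k => ?_
      simp [hL, hW, kktMatrix, hi]
    · refine (isBigO_zero G atTop).congr' ?_ EventuallyEq.rfl
      filter_upwards [eventually_eq_lamStar (s := ss) hkkt hxlim (hg i) hi] with k hk
      simp [hL, hW, kktMatrix, hi, hk, hls]
  have hWO : (fun k => r (k + 1)) =O[atTop] G := by
    obtain ⟨K, -, hK⟩ := L.exists_antilipschitzWith
      (LinearMap.ker_eq_bot.2 (kktMatrix_injective hlicq hB))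
    have h1 : W =O[atTop] fun k => L (W k) := IsBigO.of_bound K (Eventually.of_forall fun k => by
      simpa using hK.le_mul_dist (W k) 0)
    exact (h1.trans (hL1.prod_left
      ((isBigO_pi.2 hL2).prod_left (isBigO_pi.2 hL3)))).norm_left
  obtain ⟨M, hM⟩ := eventually_le_of_isBigO_mul_self (fun k => (hρ k).le) hr0
    (fun k => hr0 (k + 1)) hrlim hWO
  have hfin : (fun k => r (k + 1)) =O[atTop] fun k => ρ k + r k ^ 2 := by
    refine IsBigO.of_bound M ?_
    filter_upwards [hM] with k hk
    obtain ⟨h1, h2, h3⟩ := hnn k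
    rw [Real.norm_of_nonneg (hr0 _), Real.norm_of_nonneg (by linarith), mul_add]
    exact hk
  refine ⟨isDZStationary_of_balance (fun i => (hh i).1.differentiable (by norm_num) xs)
    (fun i => (hg i).1.differentiable (by norm_num) xs) huv hs hbal, ⟨M, M, hM⟩, ?_, ?_⟩
  · exact fun h1 => hfin.trans (h1.add (isBigO_refl _ _))
  · intro h1
    have h2 : (fun k => r k ^ 2) =o[atTop] r := by
      simpa [sq] using ((isLittleO_one_iff ℝ).2 hrlim).mul_isBigO (isBigO_refl r atTop)
    exact hfin.trans_isLittleO (h1.add h2)
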